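/- Let $G$ be a finite soluble group that can be generated by two elements and that is primitive, i.e. has a maximal subgroup $H$ whose normal core $\bigcap_{g\in G} H^g$ is trivial. Let $\Sigma(G)$ be the graph whose vertices are the elements $x\in G$ such that $\langle x,y\rangle=G$ for some $y\in G$, two distinct vertices $x_1,x_2$ being adjacent if and only if $\langle x_1,x_2\rangle\neq G$ (equivalently, the non-generating graph of $G$ with its universal vertices deleted). Let $\mathrm{soc}(G)$ be the subgroup generated by the minimal normal subgroups of $G$, and let $C_p$ denote the cyclic group of order $p$. Then $\Sigma(G)$ is disconnected if and only if there is a prime $p$ such that $G\cong C_p$ or $G/\mathrm{soc}(G)\cong C_p$. Moreover, if $\Sigma(G)$ is connected, then its diameter is at most $3$. -/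

import Mathlib

/-- `G` is generated by two (not necessarily distinct or nontrivial) elements. -/
def IsTwoGenerated (G : Type*) [Group G] : Prop :=
  ∃ x y : G, Subgroup.closure {x, y} = ⊤

/-- `G` is a primitive group: it has a maximal subgroup with trivial core. -/
def IsPrimitiveGroup (G : Type*) [Group G] : Prop :=
  ∃ H : Subgroup G, IsCoatom H ∧ H.normalCore = ⊥

/-- Minimal elements among the nontrivial normal subgroups of `G`. -/
def IsMinimalNormalSubgroup {G : Type*} [Group G] (N : Subgroup G) : Prop :=
  Minimal (fun K : Subgroup G => K.Normal ∧ K ≠ ⊥) N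

/-- The socle of `G`: the subgroup generated by all minimal normal subgroups. -/
def groupSocle (G : Type*) [Group G] : Subgroup G :=
  sSup {N : Subgroup G | IsMinimalNormalSubgroup N}

instance groupSocle_normal (G : Type*) [Group G] : (groupSocle G).Normal :=
  Subgroup.sSup_normal _ fun _ hN => (show IsMinimalNormalSubgroup _ from hN).prop.1

/-- The non-generating graph of `G`: distinct elements are adjacent when they do not
generate `G`. -/
def nonGeneratingGraph (G : Type*) [Group G] : SimpleGraph G where
  Adj x y := x ≠ y ∧ Subgroup.closure {x, y} ≠ ⊤
  symm := ⟨fun x y h => ⟨h.1.symm, by rw [Set.pair_comm]; exact h.2⟩⟩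
  loopless := ⟨fun _ h => h.1 rfl⟩

/-- The elements of `G` that belong to some generating pair. For nontrivial `G` these are
exactly the vertices of the non-generating graph that are not universal
(see `mem_generatingVertices_iff`). -/
def generatingVertices (G : Type*) [Group G] : Set G :=
  {x | ∃ y : G, Subgroup.closure {x, y} = ⊤}

theorem mem_generatingVertices_iff {G : Type*} [Group G] [Nontrivial G] (x : G) :
    x ∈ generatingVertices G ↔ ¬ ∀ y : G, y ≠ x → (nonGeneratingGraph G).Adj x y := by
  simp only [generatingVertices, Set.mem_ofPred_eq, nonGeneratingGraph]
  constructor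
  · rintro ⟨y, hy⟩ h
    by_cases hxy : y = x
    · subst hxy
      by_cases h1 : (1 : G) = y
      · subst h1
        rw [Set.pair_eq_singleton, Subgroup.closure_singleton_one] at hy
        exact bot_ne_top hy
      · rw [Set.pair_eq_singleton] at hy
        exact (h 1 h1).2 (top_unique (hy ▸ Subgroup.closure_mono (by simp)))
    · exact (h y hxy).2 hy
  · intro h
    by_contra hne
    exact h fun y hy => ⟨hy.symm, fun hc => hne ⟨y, hc⟩⟩

/-- The graph `Σ(G)`: the non-generating graph with its universal vertices deleted. -/
def sigmaGraph (G : Type*) [Group G] : SimpleGraph (generatingVertices G) :=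
  (nonGeneratingGraph G).induce (generatingVertices G)

/-! A soluble primitive group is affine: its socle `N` is an abelian, self-centralizing minimal
normal subgroup complemented by `H`. A proper supplement of `N` meets `N` trivially, so if `N` is
maximal then every nontrivial element of `N` generates `G` with every element outside `N`, and no
edge leaves `N`. If `N = ⊤`, then `G` has prime order and `1` is an isolated vertex.

Otherwise any two vertices are joined through a proper subgroup: each is within distance 1 of a
vertex in it, and two vertices inside it are within distance 1. If `G ⧸ N` is not cyclic the
subgroup is `H`, reached from `k * n` via `k`. If it is cyclic, the subgroup is some `M` strictly
between `N` and `G`. That the intermediate elements are vertices comes from `exists_closure_eq_top`,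
a counting argument resting on the conjugacy of complements (`exists_conj_eq`). -/

open Subgroup

/-! ### Minimal normal subgroups of soluble groups -/

section MinimalNormal

variable {G : Type*} [Group G]

theorem exists_isMinimalNormalSubgroup [Finite G] [Nontrivial G] :
    ∃ N : Subgroup G, IsMinimalNormalSubgroup N := by
  obtain ⟨N, -, hN⟩ := exists_minimal_le_of_wellFoundedLT
    (fun K : Subgroup G => K.Normal ∧ K ≠ ⊥) ⊤ ⟨inferInstance, top_ne_bot⟩
  exact ⟨N, hN⟩

theorem IsMinimalNormalSubgroup.le_of_normal {N L : Subgroup G}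
    (hN : IsMinimalNormalSubgroup N) (hL : L.Normal) (hLN : L ⊓ N ≠ ⊥) : N ≤ L := by
  have := hN.prop.1
  exact (hN.le_of_le ⟨inferInstance, hLN⟩ inf_le_right).trans inf_le_left

/-- Solubility makes `⁅N, N⁆` a proper subgroup of `N`; it is normal, so minimality kills it. -/
theorem IsMinimalNormalSubgroup.mul_comm_of_isSolvable {N : Subgroup G}
    (hN : IsMinimalNormalSubgroup N) (hsol : Group.IsSolvable G) :
    ∀ a ∈ N, ∀ b ∈ N, a * b = b * a := by
  have := hN.prop.1
  have hlt : ⁅N, N⁆ < N := Group.IsSolvable.commutator_lt_of_ne_bot hN.prop.2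
  have hbot : ⁅N, N⁆ = ⊥ := by
    by_contra h
    exact hlt.not_ge (hN.le_of_le ⟨inferInstance, h⟩ hlt.le)
  intro a ha b hb
  have := commutator_mem_commutator ha hb
  rw [hbot, mem_bot] at this
  exact commutatorElement_eq_one_iff_mul_comm.mp this

/-- The solutions of `a ^ q = 1` in `N` form a normal subgroup of `G`, nontrivial by Cauchy, hence
all of `N`. -/
theorem IsMinimalNormalSubgroup.pow_eq_one {N : Subgroup G} [Finite G]
    (hN : IsMinimalNormalSubgroup N) (hcomm : ∀ a ∈ N, ∀ b ∈ N, a * b = b * a)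
    {q : ℕ} (hq : q.Prime) (hdvd : q ∣ Nat.card N) : ∀ a ∈ N, a ^ q = 1 := by
  have := hN.prop.1
  have := Fact.mk hq
  let T : Subgroup G :=
    { carrier := {a | a ∈ N ∧ a ^ q = 1}
      one_mem' := ⟨one_mem _, one_pow _⟩
      mul_mem' := fun {a b} ha hb => ⟨mul_mem ha.1 hb.1, by
        rw [Commute.mul_pow (hcomm a ha.1 b hb.1), ha.2, hb.2, one_mul]⟩
      inv_mem' := fun {a} ha => ⟨inv_mem ha.1, by rw [inv_pow, ha.2, inv_one]⟩ }
  have hT : T.Normal := ⟨fun a ha g => ⟨Normal.conj_mem inferInstance a ha.1 g, by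
    rw [conj_pow, ha.2, mul_one, mul_inv_cancel]⟩⟩
  have hne : T ≠ ⊥ := by
    obtain ⟨x, hx⟩ := exists_prime_orderOf_dvd_card' (G := N) q hdvd
    intro h
    have hxT : (x : G) ∈ T := ⟨x.2, by
      have := pow_orderOf_eq_one x
      rw [hx] at this
      exact_mod_cast congrArg Subtype.val this⟩
    rw [h, mem_bot] at hxT
    have : x = 1 := Subtype.ext hxT
    rw [this, orderOf_one] at hx
    exact hq.one_lt.ne hx
  exact fun a ha => (hN.le_of_le ⟨hT, hne⟩ (fun _ h => h.1) ha).2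

end MinimalNormal

/-! ### Affine structure of soluble primitive groups -/

/-- `N` is a self-centralizing abelian minimal normal subgroup complemented by the
core-free maximal subgroup `H`. -/
structure IsAffineDecomposition {G : Type*} [Group G] (N H : Subgroup G) : Prop where
  minimal : IsMinimalNormalSubgroup N
  mul_comm : ∀ a ∈ N, ∀ b ∈ N, a * b = b * a
  isCoatom : IsCoatom H
  core_eq : H.normalCore = ⊥
  centralizer_le : ∀ g, (∀ a ∈ N, g * a = a * g) → g ∈ N

theorem eq_bot_of_normal_of_le {G : Type*} [Group G] {H L : Subgroup G}
    (hcore : H.normalCore = ⊥) (hL : L.Normal) (hle : L ≤ H) : L = ⊥ :=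
  le_bot_iff.mp (hcore ▸ normal_le_normalCore.mpr hle)

/-- A subgroup supplementing a normal abelian subgroup meets it in a normal subgroup. -/
theorem normal_inf_of_sup_eq_top {G : Type*} [Group G] {N K : Subgroup G} (hN : N.Normal)
    (hcomm : ∀ a ∈ N, ∀ b ∈ N, a * b = b * a) (hK : K ⊔ N = ⊤) : (K ⊓ N).Normal := by
  refine ⟨fun a ha g => mem_inf.mpr ⟨?_, hN.conj_mem a ha.2 g⟩⟩
  obtain ⟨k, hk, n, hn, rfl⟩ := mem_sup_of_normal_right.mp (hK ▸ mem_top g)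
  have : k * n * a * (k * n)⁻¹ = k * a * k⁻¹ := by
    rw [mul_assoc k n a, hcomm n hn a ha.2]; group
  rw [this]
  exact mul_mem (mul_mem hk ha.1) (inv_mem hk)

theorem exists_isAffineDecomposition {G : Type*} [Group G] [Finite G]
    (hprim : IsPrimitiveGroup G) (hsol : Group.IsSolvable G) :
    ∃ N H : Subgroup G, IsAffineDecomposition N H := by
  obtain ⟨H, hH, hcore⟩ := hprim
  have : Nontrivial G := by
    by_contra h
    rw [not_nontrivial_iff_subsingleton] at h
    exact hH.1 (Subsingleton.elim _ _)
  obtain ⟨N, hN⟩ := exists_isMinimalNormalSubgroup (G := G)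
  have hcomm := hN.mul_comm_of_isSolvable hsol
  have hNn := hN.prop.1
  have hsup : H ⊔ N = ⊤ := by
    refine hH.2 _ (lt_of_le_of_ne le_sup_left fun h => hN.prop.2 ?_)
    exact eq_bot_of_normal_of_le hcore hNn (h ▸ le_sup_right)
  refine ⟨N, H, hN, hcomm, hH, hcore, fun g hg => ?_⟩
  -- `C` is normalized by `H` and centralized by `N`, so it is normal in `G = NH` and lies in the
  -- trivial core of `H`.
  let C : Subgroup G := centralizer (N : Set G) ⊓ H
  have hC : C.Normal := by
    refine ⟨fun c hc g => ?_⟩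
    obtain ⟨n, hn, h, hh, rfl⟩ := mem_sup_of_normal_left.mp
      ((sup_comm H N ▸ hsup : N ⊔ H = ⊤) ▸ mem_top g)
    have h1 : h * c * h⁻¹ ∈ centralizer (N : Set G) :=
      Normal.conj_mem (inferInstance : (centralizer (N : Set G)).Normal) c hc.1 h
    have h2 : n * h * c * (n * h)⁻¹ = h * c * h⁻¹ := by
      have := mem_centralizer_iff.mp h1 n hn
      calc n * h * c * (n * h)⁻¹ = n * (h * c * h⁻¹) * n⁻¹ := by group
        _ = h * c * h⁻¹ := by rw [this]; group
    rw [h2]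
    exact mem_inf.mpr ⟨h1, mul_mem (mul_mem hh hc.2) (inv_mem hh)⟩
  have hC1 : C = ⊥ := eq_bot_of_normal_of_le hcore hC inf_le_right
  obtain ⟨h, hh, n, hn, rfl⟩ := mem_sup_of_normal_right.mp (hsup ▸ mem_top g)
  have : h ∈ C := by
    refine ⟨mem_centralizer_iff.mpr fun a ha => ?_, hh⟩
    have h1 := hg a ha
    have h2 := hcomm n hn a ha
    have : h * a * n = a * h * n := by rw [mul_assoc h a n, ← h2, ← mul_assoc, h1, mul_assoc]
    exact (mul_right_cancel this).symm
  rw [hC1, mem_bot] at this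
  rw [this, one_mul]
  exact hn

namespace IsAffineDecomposition

variable {G : Type*} [Group G] {N H : Subgroup G}

theorem normal (h : IsAffineDecomposition N H) : N.Normal := h.minimal.prop.1

/-- If `L` met `N` trivially it would centralize `N`, hence lie inside `N` and be trivial. -/
theorem le_of_normal (h : IsAffineDecomposition N H) {L : Subgroup G} (hL : L.Normal)
    (hne : L ≠ ⊥) : N ≤ L := by
  refine h.minimal.le_of_normal hL fun hLN => hne ?_
  have hNn := h.normal
  rw [← hLN, eq_comm, inf_eq_left]
  intro g hg
  exact h.centralizer_le g fun a ha =>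
    (commute_of_normal_of_disjoint L N hL hNn (disjoint_iff.mpr hLN) g a hg ha).eq

theorem socle_eq (h : IsAffineDecomposition N H) : groupSocle G = N := by
  refine le_antisymm (sSup_le fun M hM => ?_) (le_sSup h.minimal)
  have hM' : IsMinimalNormalSubgroup M := hM
  exact hM'.le_of_le h.minimal.prop (h.le_of_normal hM'.prop.1 hM'.prop.2)

theorem sup_eq_top (h : IsAffineDecomposition N H) : H ⊔ N = ⊤ := by
  refine h.isCoatom.2 _ (lt_of_le_of_ne le_sup_left fun e => h.minimal.prop.2 ?_)
  exact eq_bot_of_normal_of_le h.core_eq h.normal (e ▸ le_sup_right)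

theorem inf_eq_bot (h : IsAffineDecomposition N H) {K : Subgroup G} (hK : K ⊔ N = ⊤)
    (hne : K ≠ ⊤) : K ⊓ N = ⊥ := by
  by_contra hb
  have hle := h.minimal.le_of_le ⟨normal_inf_of_sup_eq_top h.normal h.mul_comm hK, hb⟩
    inf_le_right
  exact hne (by rw [← hK, eq_comm, sup_eq_left]; exact hle.trans inf_le_left)

/-- If a normal subgroup strictly above `N` has prime exponent `q` modulo `N`, then `q` does
not divide the order of `N`. -/
theorem not_dvd_card (h : IsAffineDecomposition N H) [Finite G] {B : Subgroup G}
    (hB : B.Normal) (hNB : N < B) {q : ℕ} (hq : q.Prime) (hpow : ∀ b ∈ B, b ^ q ∈ N) :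
    ¬ q ∣ Nat.card N := by
  intro hdvd
  have := Fact.mk hq
  have hexp := h.minimal.pow_eq_one h.mul_comm hq hdvd
  -- If `q` divided `|N|`, `B` would be a `q`-group killed by `q ^ 2`. Its nontrivial center is
  -- normal in `G`, so contains `N`, and `B` would centralize `N`.
  have hBq : IsPGroup q B := isPGroup_iff_pow_pow_eq_one.mpr fun b => ⟨2, by
    apply Subtype.ext
    push_cast
    rw [pow_two, pow_mul]
    exact hexp _ (hpow b b.2)⟩
  have : Nontrivial B := nontrivial_iff_ne_bot _ |>.mpr (ne_bot_of_gt hNB)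
  have hZ : (center B).map B.subtype ≠ ⊥ := by
    rw [Ne, map_eq_bot_iff_of_injective _ B.subtype_injective]
    exact (IsPGroup.bot_lt_center hBq).ne'
  have hZn : ((center B).map B.subtype).Normal := inferInstance
  have hle := h.le_of_normal hZn hZ
  refine hNB.not_ge fun b hb => h.centralizer_le b fun a ha => ?_
  obtain ⟨z, hz, rfl⟩ := hle ha
  have := mem_center_iff.mp hz ⟨b, hb⟩
  exact congrArg Subtype.val this

/-- `B` is the preimage of a minimal normal subgroup of `G ⧸ N`, which has prime exponent. -/
theorem exists_normal_gt (h : IsAffineDecomposition N H) [Finite G]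
    (hsol : Group.IsSolvable G) (hN : N ≠ ⊤) :
    ∃ B : Subgroup G, B.Normal ∧ N < B ∧ ∃ q : ℕ, q.Prime ∧ ∀ b ∈ B, b ^ q ∈ N := by
  have := h.normal
  have : Nontrivial (G ⧸ N) := QuotientGroup.nontrivial_iff.mpr hN
  obtain ⟨M, hM⟩ := exists_isMinimalNormalSubgroup (G := G ⧸ N)
  have hc := hM.mul_comm_of_isSolvable inferInstance
  have hcard : Nat.card M ≠ 1 := fun e => hM.prop.2 (card_eq_one.mp e)
  obtain ⟨q, hq, hdvd⟩ := Nat.exists_prime_and_dvd hcard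
  have hexp := hM.pow_eq_one hc hq hdvd
  have := hM.prop.1
  refine ⟨M.comap (QuotientGroup.mk' N), inferInstance, ?_, q, hq, fun b hb => ?_⟩
  · refine lt_of_le_of_ne (fun n hn => ?_) fun e => hM.prop.2 ?_
    · rw [mem_comap, QuotientGroup.mk'_apply, (QuotientGroup.eq_one_iff n).mpr hn]
      exact one_mem _
    · rw [← map_comap_eq_self_of_surjective (QuotientGroup.mk'_surjective N) M, ← e,
        QuotientGroup.map_mk'_self]
  · rw [← QuotientGroup.eq_one_iff, QuotientGroup.mk_pow]
    exact hexp _ hb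

/-- Every proper supplement of `N` is conjugate to `H` by an element of `G`. -/
theorem exists_conj_eq (h : IsAffineDecomposition N H) [Finite G]
    (hsol : Group.IsSolvable G) (hN : N ≠ ⊤) {K : Subgroup G} (hK : K ⊔ N = ⊤)
    (hne : K ≠ ⊤) : ∃ g : G, ∀ x, x ∈ K ↔ g * x * g⁻¹ ∈ H := by
  have := h.normal
  obtain ⟨B, hB, hNB, q, hq, hpow⟩ := h.exists_normal_gt hsol hN
  have hnd := h.not_dvd_card hB hNB hq hpow
  have := Fact.mk hq
  -- `L ⊓ B` is a `q`-group complementing the `q'`-group `N` in `B`, so Sylow's theorem will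
  -- conjugate `K ⊓ B` to `H ⊓ B`.
  have key : ∀ L : Subgroup G, L ⊔ N = ⊤ → L ≠ ⊤ →
      ∃ P : Sylow q B, (P : Subgroup B) = L.subgroupOf B := by
    intro L hL hLne
    have hbot := h.inf_eq_bot hL hLne
    have hp : IsPGroup q (L.subgroupOf B) := isPGroup_iff_pow_pow_eq_one.mpr fun b => ⟨1, by
      have hb : ((b : B) : G) ^ q ∈ L ⊓ N :=
        ⟨pow_mem (mem_subgroupOf.mp b.2) q, hpow _ (b : B).2⟩
      rw [hbot, mem_bot] at hb
      rw [pow_one]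
      exact Subtype.ext (Subtype.ext hb)⟩
    have hcompl : IsComplement' (L.subgroupOf B) (N.subgroupOf B) := by
      apply isComplement'_of_disjoint_and_mul_eq_univ
      · rw [disjoint_iff, eq_bot_iff]
        rintro b ⟨hb1, hb2⟩
        have : (b : G) ∈ L ⊓ N := ⟨hb1, hb2⟩
        rw [hbot, mem_bot] at this
        exact mem_bot.mpr (Subtype.ext this)
      · refine Set.eq_univ_of_forall fun b => ?_
        obtain ⟨l, hl, n, hn, e⟩ := mem_sup_of_normal_right.mp (hL ▸ mem_top (b : G))
        have hlB : l ∈ B := by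
          have : l = b * n⁻¹ := by rw [← e]; group
          rw [this]
          exact mul_mem b.2 (inv_mem (hNB.le hn))
        exact Set.mem_mul.mpr ⟨⟨l, hlB⟩, hl, ⟨n, hNB.le hn⟩, hn, Subtype.ext e⟩
    have hidx : ¬ q ∣ (L.subgroupOf B).index := by
      rw [hcompl.symm.index_eq_card]
      rwa [Nat.card_congr (subgroupOfEquivOfLe hNB.le).toEquiv]
    exact ⟨hp.toSylow hidx, rfl⟩
  obtain ⟨P, hP⟩ := key K hK hne
  obtain ⟨Q, hQ⟩ := key H h.sup_eq_top h.isCoatom.1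
  obtain ⟨b, hb⟩ := MulAction.exists_smul_eq B P Q
  have hconj : ∀ x ∈ B, x ∈ K ↔ (b : G) * x * (b : G)⁻¹ ∈ H := by
    intro x hx
    have h1 : (⟨x, hx⟩ : B) ∈ (P : Subgroup B) ↔ x ∈ K := by rw [hP]; rfl
    have h2 : b * ⟨x, hx⟩ * b⁻¹ ∈ (Q : Subgroup B) ↔ (b : G) * x * (b : G)⁻¹ ∈ H := by
      rw [hQ]; rfl
    rw [← h1, ← h2, ← hb, Sylow.coe_subgroup_smul, ← MulAut.conj_apply,
      ← MulAut.smul_def, smul_mem_pointwise_smul_iff]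
  let A : Subgroup G := H ⊓ B
  -- Maximality and trivial core make `H` the full normalizer of `A`; the conjugate of `K`
  -- normalizes `A`, so it lies in `H`.
  have hHA : H ≤ normalizer (A : Set G) := le_normalizer_iff.mpr fun y hy a ha =>
    mem_inf.mpr ⟨mul_mem (mul_mem hy ha.1) (inv_mem hy), hB.conj_mem a ha.2 y⟩
  have hAne : A ≠ ⊥ := by
    intro hA
    refine hNB.not_ge fun x hx => ?_
    obtain ⟨y, hy, n, hn, rfl⟩ := mem_sup_of_normal_right.mp (h.sup_eq_top ▸ mem_top x)
    have : y ∈ A := ⟨hy, by simpa using mul_mem hx (inv_mem (hNB.le hn))⟩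
    rw [hA, mem_bot] at this
    simpa [this] using hn
  have hnorm : normalizer (A : Set G) = H := by
    by_contra hneq
    have := h.isCoatom.2 _ (lt_of_le_of_ne hHA (Ne.symm hneq))
    exact hAne (eq_bot_of_normal_of_le h.core_eq (normalizer_eq_top_iff.mp this) inf_le_left)
  have hle : ∀ x ∈ K, (b : G) * x * (b : G)⁻¹ ∈ H := by
    intro x hx
    have hmem : ∀ y ∈ K, ∀ a ∈ A, (b * y * (b : G)⁻¹) * a * (b * y * (b : G)⁻¹)⁻¹ ∈ A := by
      intro y hy a ha
      have ha' : (b : G)⁻¹ * a * b ∈ K := by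
        rw [hconj _ (by simpa using hB.conj_mem a ha.2 (b : G)⁻¹)]
        simpa [mul_assoc] using ha.1
      refine mem_inf.mpr ⟨?_, hB.conj_mem a ha.2 _⟩
      have e : (b * y * (b : G)⁻¹) * a * (b * y * (b : G)⁻¹)⁻¹ =
        b * (y * ((b : G)⁻¹ * a * b) * y⁻¹) * (b : G)⁻¹ := by group
      rw [e, ← hconj]
      · exact mul_mem (mul_mem hy ha') (inv_mem hy)
      · exact hB.conj_mem _ (by simpa using hB.conj_mem a ha.2 (b : G)⁻¹) _
    rw [← hnorm, mem_normalizer_iff]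
    intro a
    refine ⟨hmem x hx a, fun ha => ?_⟩
    have := hmem x⁻¹ (inv_mem hx) _ ha
    convert this using 1
    group
  refine ⟨b, fun x => ⟨hle x, fun hx => ?_⟩⟩
  obtain ⟨k, hk, n, hn, rfl⟩ := mem_sup_of_normal_right.mp (hK ▸ mem_top x)
  have hn' : (b : G) * n * (b : G)⁻¹ ∈ H ⊓ N := by
    refine mem_inf.mpr ⟨?_, h.normal.conj_mem n hn _⟩
    have := mul_mem (inv_mem (hle k hk)) hx
    convert this using 1
    group
  rw [h.inf_eq_bot h.sup_eq_top h.isCoatom.1, mem_bot, conj_eq_one_iff] at hn'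
  rwa [hn', mul_one]

/-- A nontrivial element that can be completed to a generating pair modulo `N` can be
completed to a generating pair. -/
theorem exists_closure_eq_top (h : IsAffineDecomposition N H) [Finite G]
    (hsol : Group.IsSolvable G) (hN : N ≠ ⊤) {g y : G} (hg : g ≠ 1)
    (hgy : closure {g, y} ⊔ N = ⊤) : ∃ z : G, closure {g, z} = ⊤ := by
  have := h.normal
  by_contra hcon
  push Not at hcon
  have hsup : ∀ n : N, closure {g, y * n} ⊔ N = ⊤ := by
    intro n
    rw [eq_top_iff, ← hgy, sup_le_iff]
    refine ⟨(closure_le _).mpr ?_, le_sup_right⟩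
    rintro x (rfl | rfl)
    · exact mem_sup_left (subset_closure (by simp))
    · exact mem_sup_of_normal_right.mpr
        ⟨x * n, subset_closure (by simp), (n : G)⁻¹, inv_mem n.2, by group⟩
  -- If no lift `y * n` works, each yields a conjugate of `H`; the conjugating element may be taken
  -- in `N` since `G = HN`.
  have hconj : ∀ n : N, ∃ m : N, ∀ x, x ∈ closure {g, y * (n : G)} ↔
      (m : G) * x * (m : G)⁻¹ ∈ H := by
    intro n
    obtain ⟨c, hc⟩ := h.exists_conj_eq hsol hN (hsup n) (hcon _)
    obtain ⟨k, hk, m, hm, rfl⟩ := mem_sup_of_normal_right.mp (h.sup_eq_top ▸ mem_top c)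
    refine ⟨⟨m, hm⟩, fun x => (hc x).trans ?_⟩
    have e : k * m * x * (k * m)⁻¹ = k * (m * x * m⁻¹) * k⁻¹ := by group
    rw [e, H.mul_mem_cancel_right (inv_mem hk), H.mul_mem_cancel_left hk]
  choose f hf using hconj
  have hinj : Function.Injective f := by
    intro n n' e
    have h1 : y * (n' : G) ∈ closure {g, y * (n : G)} := by
      rw [hf, e, ← hf]
      exact subset_closure (by simp)
    have h2 : y * (n : G) ∈ closure {g, y * (n : G)} := subset_closure (by simp)
    have h3 : (n : G)⁻¹ * n' ∈ closure {g, y * (n : G)} ⊓ N :=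
      mem_inf.mpr ⟨by convert mul_mem (inv_mem h2) h1 using 1; group, mul_mem (inv_mem n.2) n'.2⟩
    rw [h.inf_eq_bot (hsup n) (hcon _), mem_bot, inv_mul_eq_one] at h3
    exact Subtype.ext h3
  -- So every conjugate of `H` by an element of `N`, hence every conjugate, arises from some `n` and
  -- contains `g`; thus `g` is in the core.
  have hsurj := Finite.surjective_of_injective hinj
  refine hg ?_
  rw [← mem_bot, ← h.core_eq]
  intro c
  obtain ⟨k, hk, m, hm, rfl⟩ := mem_sup_of_normal_right.mp (h.sup_eq_top ▸ mem_top c)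
  obtain ⟨n, hn⟩ := hsurj ⟨m, hm⟩
  have h1 : g ∈ closure {g, y * (n : G)} := subset_closure (by simp)
  rw [hf, hn] at h1
  have e : k * m * g * (k * m)⁻¹ = k * (m * g * m⁻¹) * k⁻¹ := by group
  rw [e]
  exact mul_mem (mul_mem hk h1) (inv_mem hk)

end IsAffineDecomposition

/-! ### Distances in the graph -/

section Graph

variable {G : Type*} [Group G]

theorem sigmaGraph_edist_le_one {u v : generatingVertices G}
    (h : closure {(u : G), (v : G)} ≠ ⊤) : (sigmaGraph G).edist u v ≤ 1 := by
  rw [SimpleGraph.edist_le_one_iff_adj_or_eq]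
  by_cases huv : u = v
  · exact Or.inr huv
  · exact Or.inl ⟨fun e => huv (Subtype.ext e), h⟩

theorem edist_le_three {V : Type*} {Γ : SimpleGraph V} {a b c d : V} (hab : Γ.edist a b ≤ 1)
    (hbc : Γ.edist b c ≤ 1) (hcd : Γ.edist c d ≤ 1) : Γ.edist a d ≤ 3 := by
  calc Γ.edist a d ≤ Γ.edist a b + Γ.edist b d := Γ.edist_triangle
    _ ≤ Γ.edist a b + (Γ.edist b c + Γ.edist c d) := by gcongr; exact Γ.edist_triangle
    _ ≤ 1 + (1 + 1) := by gcongr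
    _ = 3 := by norm_num

theorem closure_ne_top_of_le {S : Set G} {M : Subgroup G} (hM : M ≠ ⊤) (hS : S ⊆ M) :
    closure S ≠ ⊤ :=
  fun e => hM (top_le_iff.mp (e ▸ (closure_le M).mpr hS))

theorem sigmaGraph_connected_of_edist (hne : (generatingVertices G).Nonempty)
    (h : ∀ u v, (sigmaGraph G).edist u v ≤ 3) : (sigmaGraph G).Connected := by
  have : Nonempty (generatingVertices G) := hne.to_subtype
  refine ⟨fun u v => SimpleGraph.edist_ne_top_iff_reachable.mp fun e => ?_⟩
  have := h u v
  rw [e, top_le_iff] at this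
  exact absurd this (by decide)

end Graph

/-! ### Groups of prime order -/

/-- A nontrivial finite group without proper nontrivial subgroups has prime order. -/
theorem exists_prime_mulEquiv_of_forall_eq {Q : Type*} [Group Q] [Finite Q] [Nontrivial Q]
    (h : ∀ K : Subgroup Q, K = ⊥ ∨ K = ⊤) :
    ∃ p : ℕ, p.Prime ∧ Nonempty (Q ≃* Multiplicative (ZMod p)) := by
  obtain ⟨p, hp, hdvd⟩ := Nat.exists_prime_and_dvd (Finite.one_lt_card (α := Q)).ne'
  have := Fact.mk hp
  obtain ⟨x, hx⟩ := exists_prime_orderOf_dvd_card' (G := Q) p hdvd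
  have hx1 : zpowers x ≠ ⊥ := by
    rw [Ne, zpowers_eq_bot]
    rintro rfl
    rw [orderOf_one] at hx
    exact hp.one_lt.ne hx
  have hcard : Nat.card Q = p := by
    rw [← hx, ← Nat.card_zpowers, (h _).resolve_left hx1, card_top]
  exact ⟨p, hp, ⟨mulEquivOfPrimeCardEq (p := p) hcard (by simp)⟩⟩

theorem eq_bot_or_eq_top_of_mulEquiv {Q : Type*} [Group Q] {p : ℕ} (hp : p.Prime)
    (e : Q ≃* Multiplicative (ZMod p)) (K : Subgroup Q) : K = ⊥ ∨ K = ⊤ := by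
  have := Fact.mk hp
  have hcard : Nat.card Q = p := by rw [Nat.card_congr e.toEquiv]; simp
  have : Fact (Nat.card Q).Prime := ⟨hcard ▸ hp⟩
  exact K.eq_bot_or_eq_top_of_prime_card

/-- The non-generating graph of a group of prime order is not connected. -/
theorem sigmaGraph_not_connected_of_prime {G : Type*} [Group G] [Nontrivial G]
    (h : ∀ K : Subgroup G, K = ⊥ ∨ K = ⊤) : ¬ (sigmaGraph G).Connected := by
  intro hcon
  have hgen : ∀ x : G, x ≠ 1 → ∀ S : Set G, x ∈ S → closure S = ⊤ := by
    intro x hx S hS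
    refine (h _).resolve_left fun e => hx ?_
    rw [← mem_bot, ← e]
    exact subset_closure hS
  obtain ⟨g, hg⟩ := exists_ne (1 : G)
  let u : generatingVertices G := ⟨1, g, hgen g hg _ (by simp)⟩
  let v : generatingVertices G := ⟨g, g, hgen g hg _ (by simp)⟩
  have : Nontrivial (generatingVertices G) :=
    ⟨u, v, fun e => hg (congrArg Subtype.val e).symm⟩
  obtain ⟨w, hw⟩ := hcon.preconnected.exists_adj_of_nontrivial u
  have hw' : (1 : G) ≠ w ∧ closure {(1 : G), (w : G)} ≠ ⊤ := hw
  exact hw'.2 (hgen w hw'.1.symm _ (by simp))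

/-! ### Connectedness according to the quotient by the socle -/

namespace IsAffineDecomposition

variable {G : Type*} [Group G] {N H : Subgroup G}

/-- Otherwise `G` would be cyclic, so abelian, and would centralize `N`. -/
theorem one_notMem_generatingVertices (h : IsAffineDecomposition N H) (hN : N ≠ ⊤) :
    (1 : G) ∉ generatingVertices G := by
  rintro ⟨y, hy⟩
  refine hN (eq_top_iff.mpr fun g _ => h.centralizer_le g fun a _ => ?_)
  have hz : ∀ x : G, x ∈ zpowers y := by
    intro x
    have hle : closure {1, y} ≤ zpowers y := (closure_le _).mpr (by
      rintro x (rfl | rfl)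
      · exact one_mem _
      · exact mem_zpowers x)
    exact hle (hy ▸ mem_top x)
  obtain ⟨i, rfl⟩ := hz g
  obtain ⟨j, rfl⟩ := hz a
  exact (Commute.zpow_zpow_self y i j).eq

theorem sigmaGraph_not_connected (h : IsAffineDecomposition N H) (hN : IsCoatom N) :
    ¬ (sigmaGraph G).Connected := by
  have hgen : ∀ n ∈ N, n ≠ 1 → ∀ y ∉ N, closure {n, y} = ⊤ := by
    intro n hn hn1 y hy
    by_contra hne
    have hsup : closure {n, y} ⊔ N = ⊤ :=
      hN.2 _ (lt_of_le_of_ne le_sup_right fun e =>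
        hy (e ▸ mem_sup_left (subset_closure (by simp))))
    have := h.inf_eq_bot hsup hne
    refine hn1 ?_
    rw [← mem_bot, ← this]
    exact mem_inf.mpr ⟨subset_closure (by simp), hn⟩
  intro hcon
  obtain ⟨n, hn, hn1⟩ := N.bot_or_exists_ne_one.resolve_left h.minimal.prop.2
  obtain ⟨y, hy⟩ : ∃ y, y ∉ N := by
    by_contra! hall
    exact hN.1 (eq_top_iff.mpr fun x _ => hall x)
  let u : generatingVertices G := ⟨n, y, hgen n hn hn1 y hy⟩
  let v : generatingVertices G := ⟨y, n, by rw [Set.pair_comm]; exact hgen n hn hn1 y hy⟩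
  obtain ⟨w⟩ := hcon.preconnected u v
  have key : ∀ {a b : generatingVertices G}, (sigmaGraph G).Walk a b →
      (a : G) ∈ N → (b : G) ∈ N := by
    intro a b w
    induction w with
    | nil => exact id
    | @cons a b c hab _ ih =>
      intro ha
      refine ih ?_
      by_contra hb
      have hab' : (a : G) ≠ b ∧ closure {(a : G), (b : G)} ≠ ⊤ := hab
      refine hab'.2 (hgen a ha ?_ b hb)
      intro e
      exact h.one_notMem_generatingVertices hN.1 (e ▸ a.2)
  exact hy (key w hn)

theorem edist_le_three_of_not_isCyclic (h : IsAffineDecomposition N H) [Finite G]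
    (hsol : Group.IsSolvable G) (hN : N ≠ ⊤) (hcyc : ∀ y : G, zpowers y ⊔ N ≠ ⊤)
    (u v : generatingVertices G) : (sigmaGraph G).edist u v ≤ 3 := by
  have := h.normal
  have key : ∀ u : generatingVertices G, ∃ w : generatingVertices G,
      (w : G) ∈ H ∧ closure {(u : G), (w : G)} ≠ ⊤ := by
    rintro ⟨x, y, hxy⟩
    obtain ⟨k, hk, n, hn, rfl⟩ := mem_sup_of_normal_right.mp (h.sup_eq_top ▸ mem_top x)
    -- If `k = 1`, then `x ∈ N` and `y` alone generates `G` modulo `N`.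
    have hk1 : k ≠ 1 := by
      rintro rfl
      refine hcyc y (eq_top_iff.mpr (hxy ▸ (closure_le _).mpr ?_))
      rintro z (rfl | rfl)
      · exact mem_sup_right (by simpa using hn)
      · exact mem_sup_left (mem_zpowers z)
    have hsup : closure {k, y} ⊔ N = ⊤ := by
      refine eq_top_iff.mpr (hxy ▸ (closure_le _).mpr ?_)
      rintro z (rfl | rfl)
      · exact mul_mem (mem_sup_left (subset_closure (by simp))) (mem_sup_right hn)
      · exact mem_sup_left (subset_closure (by simp))
    refine ⟨⟨k, h.exists_closure_eq_top hsol hN hk1 hsup⟩, hk,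
      closure_ne_top_of_le (hcyc k) ?_⟩
    rintro z (rfl | rfl)
    · exact mul_mem (mem_sup_left (mem_zpowers k)) (mem_sup_right hn)
    · exact mem_sup_left (mem_zpowers _)
  obtain ⟨u', hu', huu'⟩ := key u
  obtain ⟨v', hv', hvv'⟩ := key v
  refine edist_le_three (sigmaGraph_edist_le_one huu') (sigmaGraph_edist_le_one
    (closure_ne_top_of_le h.isCoatom.1 ?_)) (sigmaGraph_edist_le_one
    (Set.pair_comm (v : G) v' ▸ hvv'))
  rintro z (rfl | rfl) <;> assumption

theorem edist_le_three_of_isCyclic (h : IsAffineDecomposition N H) [Finite G]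
    (hsol : Group.IsSolvable G) {y : G} (hy : zpowers y ⊔ N = ⊤) {M : Subgroup G}
    (hNM : N < M) (hM : M ≠ ⊤) (u v : generatingVertices G) :
    (sigmaGraph G).edist u v ≤ 3 := by
  have := h.normal
  have hN : N ≠ ⊤ := hNM.ne_top
  have hvert : ∀ g : G, g ≠ 1 → g ∈ generatingVertices G := by
    intro g hg
    refine h.exists_closure_eq_top hsol hN hg (y := y) (top_le_iff.mp (hy ▸ ?_))
    exact sup_le_sup_right (by
      rw [zpowers_eq_closure]; exact closure_mono (by simp)) N
  have hzne : ∀ x : G, zpowers x ≠ ⊤ := by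
    intro x hx
    refine h.one_notMem_generatingVertices hN ⟨x, top_le_iff.mp (hx ▸ ?_)⟩
    rw [zpowers_eq_closure]
    exact closure_mono (by simp)
  have key : ∀ u : generatingVertices G, ∃ w : generatingVertices G,
      (w : G) ∈ M ∧ closure {(u : G), (w : G)} ≠ ⊤ := by
    rintro ⟨x, hx⟩
    -- If `x` generates `G` modulo `N`, some power of `x` lies in `M` outside `N`; if not, any
    -- nontrivial element of `N` serves.
    by_cases hxN : zpowers x ⊔ N = ⊤
    · obtain ⟨m, hm, hmN⟩ := SetLike.exists_of_lt hNM
      obtain ⟨_, ⟨k, rfl⟩, n, hn, e⟩ := mem_sup_of_normal_right.mp (hxN ▸ mem_top m)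
      have e' : x ^ k = m * n⁻¹ := by rw [← e]; group
      have hne : x ^ k ≠ 1 := fun e1 => hmN (by
        rw [← e]; simpa [e1] using hn)
      refine ⟨⟨x ^ k, hvert _ hne⟩, by
        simpa only [e'] using mul_mem hm (inv_mem (hNM.le hn)),
        closure_ne_top_of_le (hzne x) ?_⟩
      rintro z (rfl | rfl)
      · exact mem_zpowers _
      · exact zpow_mem (mem_zpowers x) k
    · obtain ⟨n, hn, hn1⟩ := N.bot_or_exists_ne_one.resolve_left h.minimal.prop.2
      refine ⟨⟨n, hvert n hn1⟩, hNM.le hn, closure_ne_top_of_le hxN ?_⟩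
      rintro z (rfl | rfl)
      · exact mem_sup_left (mem_zpowers _)
      · exact mem_sup_right hn
  obtain ⟨u', hu', huu'⟩ := key u
  obtain ⟨v', hv', hvv'⟩ := key v
  refine edist_le_three (sigmaGraph_edist_le_one huu') (sigmaGraph_edist_le_one
    (closure_ne_top_of_le hM ?_)) (sigmaGraph_edist_le_one
    (Set.pair_comm (v : G) v' ▸ hvv'))
  rintro z (rfl | rfl) <;> assumption

theorem eq_bot_or_eq_top (h : IsAffineDecomposition N H) (hN : N = ⊤) (K : Subgroup G) :
    K = ⊥ ∨ K = ⊤ := by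
  rw [or_iff_not_imp_left]
  intro hK
  have hKn : K.Normal := ⟨fun k hk g => by
    rw [h.mul_comm g (hN ▸ mem_top g) k (hN ▸ mem_top k)]; simpa using hk⟩
  exact top_le_iff.mp (hN ▸ h.le_of_normal hKn hK)

end IsAffineDecomposition

/-! ### The quotient by the socle and the main theorem -/

/-- The subgroups of `G ⧸ N` are trivial exactly when `N` is maximal. -/
theorem isCoatom_iff_forall_eq {G : Type*} [Group G] {N : Subgroup G} [N.Normal]
    (hN : N ≠ ⊤) : IsCoatom N ↔ ∀ K : Subgroup (G ⧸ N), K = ⊥ ∨ K = ⊤ := by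
  have hsurj := QuotientGroup.mk'_surjective N
  constructor
  · intro h K
    have hle : N ≤ K.comap (QuotientGroup.mk' N) := by
      simpa using ker_le_comap (QuotientGroup.mk' N) K
    rw [← map_comap_eq_self_of_surjective hsurj K]
    rcases h.le_iff.mp hle with e | e
    · exact Or.inr (by rw [e, map_top_of_surjective _ hsurj])
    · exact Or.inl (by rw [e, QuotientGroup.map_mk'_self])
  · refine fun h => ⟨hN, fun M hM => ?_⟩
    have hker : (QuotientGroup.mk' N).ker ≤ M := by simpa using hM.le
    rw [← comap_map_eq_self hker]
    rcases h (M.map (QuotientGroup.mk' N)) with e | e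
    · refine absurd ?_ hM.not_ge
      simpa using (Subgroup.map_eq_bot_iff _).mp e
    · rw [e, comap_top]

theorem mainTheorem5 (G : Type*) [Group G] [Finite G] (hgen : IsTwoGenerated G)
    (hprim : IsPrimitiveGroup G) (hsol : Group.IsSolvable G) :
    (¬ (sigmaGraph G).Connected ↔
      ∃ p : ℕ, p.Prime ∧ (Nonempty (G ≃* Multiplicative (ZMod p)) ∨
        Nonempty (G ⧸ groupSocle G ≃* Multiplicative (ZMod p)))) ∧
    ((sigmaGraph G).Connected → (sigmaGraph G).ediam ≤ 3) := by
  obtain ⟨N, H, h⟩ := exists_isAffineDecomposition hprim hsol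
  obtain rfl := h.socle_eq
  set N := groupSocle G
  have : Nontrivial G := by
    obtain ⟨n, -, hn1⟩ := N.bot_or_exists_ne_one.resolve_left h.minimal.prop.2
    exact ⟨n, 1, hn1⟩
  have hne : (generatingVertices G).Nonempty := hgen.imp fun _ hx => hx
  by_cases hN : N = ⊤
  · have htriv := h.eq_bot_or_eq_top hN
    have hnot := sigmaGraph_not_connected_of_prime htriv
    obtain ⟨p, hp, e⟩ := exists_prime_mulEquiv_of_forall_eq htriv
    exact ⟨⟨fun _ => ⟨p, hp, Or.inl e⟩, fun _ => hnot⟩, fun hc => absurd hc hnot⟩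
  have : Nontrivial (G ⧸ N) := QuotientGroup.nontrivial_iff.mpr hN
  by_cases hco : IsCoatom N
  · have hnot := h.sigmaGraph_not_connected hco
    obtain ⟨p, hp, e⟩ := exists_prime_mulEquiv_of_forall_eq ((isCoatom_iff_forall_eq hN).mp hco)
    exact ⟨⟨fun _ => ⟨p, hp, Or.inr e⟩, fun _ => hnot⟩, fun hc => absurd hc hnot⟩
  have hdist : ∀ u v, (sigmaGraph G).edist u v ≤ 3 := by
    by_cases hcyc : ∃ y : G, zpowers y ⊔ N = ⊤
    · obtain ⟨y, hy⟩ := hcyc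
      obtain ⟨M, hNM, hM⟩ : ∃ M, N < M ∧ M ≠ ⊤ := by
        by_contra! hall
        exact hco ⟨hN, hall⟩
      exact h.edist_le_three_of_isCyclic hsol hy hNM hM
    · exact h.edist_le_three_of_not_isCyclic hsol hN (not_exists.mp hcyc)
  have hcon := sigmaGraph_connected_of_edist hne hdist
  refine ⟨⟨fun hc => absurd hcon hc, ?_⟩, fun _ => SimpleGraph.ediam_le_of_edist_le hdist⟩
  rintro ⟨p, hp, ⟨⟨e⟩⟩ | ⟨⟨e⟩⟩⟩
  · exact absurd ((eq_bot_or_eq_top_of_mulEquiv hp e N).resolve_right hN) h.minimal.prop.2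
  · exact absurd ((isCoatom_iff_forall_eq hN).mpr (eq_bot_or_eq_top_of_mulEquiv hp e)) hco
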